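/- For graphs $T$ and $H$ and an integer $n$, let $ex(n,T,H)$ denote the maximum possible number of copies of $T$ (subgraphs isomorphic to $T$) in a simple graph on $n$ vertices that contains no (not necessarily induced) subgraph isomorphic to $H$. Let $s\ge 2$ and $t\ge (s-1)!+1$ be fixed integers. Then, as $n\to\infty$, $$ex(n,K_3,K_{s,t})=\Theta\left(n^{3-\frac{3}{s}}\right);$$ that is, there are positive constants $c_1,c_2$ depending only on $s$ and $t$ such that $c_1 n^{3-3/s}\le ex(n,K_3,K_{s,t})\le c_2 n^{3-3/s}$ for all sufficiently large $n$. -/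

import Mathlib

open scoped Classical in
/-- The generalized extremal number `ex(n, T, H)`: the maximum number of (unlabelled) copies of `T`,
that is, of subgraphs isomorphic to `T`, in an `H`-free simple graph on `n` vertices. Here `H`-free
means that there is no subgraph (induced or not) isomorphic to `H`.

If every graph on `n` vertices contains `H`, then this is `0`; that cannot happen if `H` has an
edge. -/
noncomputable def generalizedExtremalNumber (n : ℕ) {U W : Type*}
    (T : SimpleGraph U) (H : SimpleGraph W) : ℕ :=
  Finset.sup {G : SimpleGraph (Fin n) | H.Free G} (fun G => G.copyCount T)

/-!
The extremal order is that of a graph with all degrees about `n ^ (1 - 1 / s)` and all codegrees of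
edges about `n ^ (1 - 2 / s)`, which has about `n ^ (3 - 3 / s)` triangles.

**Upper bound.** In a `K_{s,t}`-free graph any `s` vertices have fewer than `t` common neighbours,
so double counting pairs (vertex, `s`-subset of its neighbourhood) bounds `∑ v, d(v) ^ s` by
`O(n ^ s)` (`sum_degree_pow_le`). The graph induced on the neighbourhood of a vertex `v` is
`K_{s-1,t}`-free, so the same count inside it bounds the sum of the `(s - 1)`-st powers of the
codegrees of the edges at `v` by `O(d(v) ^ (s - 1))` (`sum_codegree_pow_le`). Interpolating twice
between these moments, by the two-term inequality `pow_mul_pow_le_add` in place of Hölder's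
inequality, gives `O(n ^ (3 - 3 / s))` triangles.

**Lower bound.** The projective norm graph of a field extension `E / F` of degree `s - 1`, with
`q = #F`, has vertex set `E × Fˣ`, and `(A, a)`, `(B, b)` are adjacent when `N (A + B) = a * b`. It
has about `q ^ s` vertices. In characteristic two every element of `F` is a square, so one can solve
`a b = N (A + B)`, `a c = N (A + C)`, `b c = N (B + C)` for any distinct `A, B, C`, and each
three-element subset of `E` is the projection of a triangle
(`choose_le_card_cliqueFinset_projNormGraph`). Taking `q` a power of two with `q ^ s ≤ n < (2 q) ^ s`
gives at least a constant times `n ^ (3 - 3 / s)` triangles.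

That `s` vertices of this graph have at most `(s - 1)!` common neighbours comes from a bound on the
number of solutions of a system of `t` equations `∏ j, (x j - a i j) = b i` in `t` unknowns over an
infinite field, where for each `j` the `a i j` are distinct: there are at most `t!` solutions
(`card_le_factorial_of_forall_prod_sub_eq`). For the proof, consider the `K`-algebra map
`K[Y i] → K[X j]` that sends `Y i` to `∏ j, (X j - a i j)`.
* It is integral: in a valuation ring containing all these products, if some `X j` had a pole, each
  of the `t` products would need a factor of positive valuation among the fewer than `t` other
  columns, so two rows would use the same column, making a nonzero constant `a i j - a i' j` a
  nonunit. By comparing transcendence degrees, the map is also injective.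
* Every `h` in `K[X j]` satisfies a nonzero polynomial of degree at most `t!` over `K[Y i]`, by a
  dimension count: the images of polynomials of total degree at most `D` lie in the space of
  polynomials of degree at most `D` in each variable, and these dimensions are asymptotic to
  `D ^ t / t!` and `D ^ t`.
* Since `K[Y i]` is integrally closed, the minimal polynomial of `h` over it is monic of degree at
  most `t!`. Specialising `Y` to `b` produces a monic polynomial over `K` that has `h x` as a root
  for every solution `x`; take `h` to be a linear form separating the given solutions.
-/

/-! ### Integrality and injectivity of the product map -/

/-- An element of a field is integral over `A` if it lies in every valuation ring containing the
image of `A`. -/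
theorem isIntegral_of_forall_mem_valuationSubring {A L : Type*} [CommRing A] [Field L] [Algebra A L]
    {x : L} (h : ∀ V : ValuationSubring L, (∀ a, algebraMap A L a ∈ V) → x ∈ V) :
    IsIntegral A x := by
  by_contra hx
  let R : Subring L := (integralClosure A L).toSubring
  have : IsIntegrallyClosedIn R L :=
    inferInstanceAs (IsIntegrallyClosedIn (integralClosure A L) L)
  obtain ⟨V, hRV, hxV⟩ := Subring.exists_le_valuationSubring_of_isIntegrallyClosedIn (R := R) hx
  exact hxV (h V fun a => hRV ((integralClosure A L).algebraMap_mem a))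

/-- If the products `∏ j, (x j - a i j)` all lie in a valuation ring containing the `a i j`, and the
differences of distinct `a i j` in the same column are units there, then so do the `x j`, provided
there are at least as many rows as columns. -/
theorem mem_valuationSubring_of_prod_sub_mem {ι κ L : Type*} [Fintype ι] [Fintype κ] [Field L]
    (V : ValuationSubring L) (hcard : Fintype.card κ ≤ Fintype.card ι) (a : ι → κ → L) (x : κ → L)
    (ha : ∀ i j, a i j ∈ V) (hinv : ∀ i i' j, i ≠ i' → a i j ≠ a i' j ∧ (a i j - a i' j)⁻¹ ∈ V)
    (hx : ∀ i, ∏ j, (x j - a i j) ∈ V) (j : κ) : x j ∈ V := by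
  classical
  by_contra hj
  let v := V.valuation
  -- The factor at `j` has a pole, so in each row some factor without a pole must be a nonunit.
  have key : ∀ i, ∃ j', x j' ∈ V ∧ v (x j' - a i j') < 1 := by
    intro i
    by_contra! hcon
    have hlt : ∀ j', x j' ∉ V → 1 < v (x j' - a i j') := by
      intro j' hj'
      rw [← not_le, V.valuation_le_one_iff]
      intro hmem
      exact hj' (by simpa using V.add_mem _ _ hmem (ha i j'))
    have hle : ∀ j', 1 ≤ v (x j' - a i j') := fun j' => by
      by_cases h : x j' ∈ V
      · exact hcon j' h
      · exact (hlt j' h).le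
    have h1 := (V.valuation_le_one_iff _).2 (hx i)
    rw [← Finset.mul_prod_erase _ _ (Finset.mem_univ j), map_mul, map_prod] at h1
    have h2 : 1 ≤ ∏ j' ∈ Finset.univ.erase j, V.valuation (x j' - a i j') :=
      Finset.prod_induction _ (fun y => 1 ≤ y) (fun _ _ hu hw => one_le_mul hu hw) le_rfl
        fun j' _ => hle j'
    exact absurd h1 (not_le.2 (lt_of_lt_of_le (hlt j hj) (le_mul_of_one_le_right' h2)))
  choose g hgV hg using key
  -- The chosen columns avoid `j`, so two rows share one.
  have hninj : ¬ Function.Injective g := by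
    intro hinj
    have hbij := (Fintype.bijective_iff_injective_and_card g).2
      ⟨hinj, le_antisymm (Fintype.card_le_of_injective g hinj) hcard⟩
    obtain ⟨i, hi⟩ := hbij.2 j
    exact hj (hi ▸ hgV i)
  simp only [Function.Injective, not_forall] at hninj
  obtain ⟨i, i', hii', hne⟩ := hninj
  obtain ⟨hne', hmem⟩ := hinv i i' (g i) hne
  have h1 := hg i
  have h2 := hg i'
  rw [← hii'] at h2
  have h3 : v (a i (g i) - a i' (g i)) < 1 := by
    have := v.map_sub_lt h2 h1
    simpa using this
  have h4 := (V.valuation_le_one_iff _).2 hmem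
  rw [map_inv₀, inv_le_one₀ ((Valuation.pos_iff _).2 (sub_ne_zero.2 hne'))] at h4
  exact absurd h3 (not_lt.2 h4)

section Algebra

open MvPolynomial

variable {ι κ K : Type*} [Fintype ι] [Fintype κ] [Field K]

/-- The homomorphism `K[Y i] → K[X j]` sending `Y i` to `∏ j, (X j - a i j)`. On points it is the map
`x ↦ (∏ j, (x j - a i j))ᵢ`, whose fibres are to be counted. -/
noncomputable def prodSubHom (a : ι → κ → K) : MvPolynomial ι K →ₐ[K] MvPolynomial κ K :=
  aeval fun i => ∏ j, (X j - C (a i j))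

theorem prodSubHom_isIntegral (hcard : Fintype.card κ ≤ Fintype.card ι) (a : ι → κ → K)
    (ha : ∀ j, Function.Injective fun i => a i j) :
    (prodSubHom a).toRingHom.IsIntegral := by
  let _ : Algebra (MvPolynomial ι K) (MvPolynomial κ K) := (prodSubHom a).toRingHom.toAlgebra
  let L := FractionRing (MvPolynomial κ K)
  let c : K →+* L := (algebraMap (MvPolynomial κ K) L).comp C
  have hc : ∀ z : K, algebraMap (MvPolynomial ι K) L (C z) = c z := fun z => by
    rw [IsScalarTower.algebraMap_apply (MvPolynomial ι K) (MvPolynomial κ K)]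
    exact congrArg (algebraMap (MvPolynomial κ K) L) ((prodSubHom a).commutes z)
  have hX : ∀ j, IsIntegral (MvPolynomial ι K) (X j : MvPolynomial κ K) := by
    intro j
    refine (isIntegral_algebraMap_iff (IsFractionRing.injective (MvPolynomial κ K) L)).1
      (isIntegral_of_forall_mem_valuationSubring fun V hV => ?_)
    have hcV : ∀ z, c z ∈ V := fun z => hc z ▸ hV (C z)
    refine mem_valuationSubring_of_prod_sub_mem V hcard (fun i j => c (a i j))
      (fun j => algebraMap (MvPolynomial κ K) L (X j)) (fun i j => hcV _) ?_ ?_ j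
    · intro i i' j hii'
      refine ⟨fun h => hii' (ha j (c.injective h)), ?_⟩
      rw [← map_sub, ← map_inv₀]
      exact hcV _
    · intro i
      have h := hV (X i)
      rw [IsScalarTower.algebraMap_apply (MvPolynomial ι K) (MvPolynomial κ K),
        show algebraMap (MvPolynomial ι K) (MvPolynomial κ K) (X i) =
          ∏ j, (X j - C (a i j)) from aeval_X _ _, map_prod] at h
      simp only [map_sub] at h
      exact h
  intro p
  change IsIntegral (MvPolynomial ι K) p
  induction p using MvPolynomial.induction_on with
  | C c =>
    have : (C c : MvPolynomial κ K) = algebraMap (MvPolynomial ι K) (MvPolynomial κ K) (C c) :=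
      ((prodSubHom a).commutes c).symm
    rw [this]
    exact isIntegral_algebraMap
  | add p q hp hq => exact hp.add hq
  | mul_X p j hp => exact hp.mul (hX j)

/-- The products `∏ j, (X j - a i j)` are as many as the variables, and `K[X j]` is algebraic over
them, so they form a transcendence basis. -/
theorem prodSubHom_injective (hcard : Fintype.card ι = Fintype.card κ) (a : ι → κ → K)
    (ha : ∀ j, Function.Injective fun i => a i j) : Function.Injective (prodSubHom a) := by
  let f : ι → MvPolynomial κ K := fun i => ∏ j, (X j - C (a i j))
  have hrange : Algebra.adjoin K (Set.range f) = (prodSubHom a).range :=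
    Algebra.adjoin_range_eq_range_aeval K f
  have : Algebra.IsAlgebraic (Algebra.adjoin K (Set.range f)) (MvPolynomial κ K) := by
    refine ⟨fun p => IsIntegral.isAlgebraic ?_⟩
    obtain ⟨m, hm, hp⟩ := prodSubHom_isIntegral hcard.ge a ha p
    let φ : MvPolynomial ι K →+* Algebra.adjoin K (Set.range f) :=
      (prodSubHom a).toRingHom.codRestrict (Algebra.adjoin K (Set.range f)).toSubring
        fun q => by
          show prodSubHom a q ∈ Algebra.adjoin K (Set.range f)
          rw [hrange]; exact ⟨q, rfl⟩
    refine ⟨m.map φ, hm.map φ, ?_⟩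
    rw [Polynomial.eval₂_map]
    exact hp
  have := Algebra.IsAlgebraic.isTranscendenceBasis_of_lift_le_trdeg_of_finite K f
    (by rw [MvPolynomial.trdeg_of_isDomain]; simp [hcard])
  exact this.1

/-! ### Degree bound and number of solutions -/

theorem exists_mul_add_pow_lt (N e t : ℕ) :
    ∃ D : ℕ, N * (D + e + 1) ^ t < (N + 1) * (D + 1) ^ t := by
  -- By Bernoulli's inequality `((D + 1) / (D + e + 1)) ^ t ≥ 1 - t * e / (D + e + 1)`, and this `D`
  -- makes the right side exceed `N / (N + 1)`.
  refine ⟨t * e * (N + 1), ?_⟩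
  set D := t * e * (N + 1) with hD
  have hpos : (0 : ℝ) < D + e + 1 := by positivity
  have hB := one_add_mul_le_pow (a := -((e : ℝ) / (D + e + 1))) (by
    have : (e : ℝ) / (D + e + 1) ≤ 1 := by
      rw [div_le_one hpos]; linarith [(Nat.cast_nonneg D : (0 : ℝ) ≤ D)]
    linarith) t
  have h1 : (1 + -((e : ℝ) / (D + e + 1))) = (D + 1) / (D + e + 1) := by
    field_simp; ring
  rw [h1, div_pow, le_div_iff₀ (by positivity)] at hB
  have hDr : (D : ℝ) = t * e * (N + 1) := by rw [hD]; push_cast; ring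
  have h2 : (N : ℝ) < (N + 1) * (1 + t * -((e : ℝ) / (D + e + 1))) := by
    have : (N + 1) * (t * ((e : ℝ) / (D + e + 1))) < 1 := by
      rw [← mul_div_assoc, ← mul_div_assoc, div_lt_one hpos]
      have : (0 : ℝ) ≤ e := Nat.cast_nonneg e
      nlinarith
    nlinarith
  have h3 : (N : ℝ) * (D + e + 1) ^ t < (N + 1) * (D + 1) ^ t := by
    have hp : (0 : ℝ) < (D + e + 1) ^ t := by positivity
    calc (N : ℝ) * (D + e + 1) ^ t
        < (N + 1) * (1 + t * -((e : ℝ) / (D + e + 1))) * (D + e + 1) ^ t :=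
          mul_lt_mul_of_pos_right h2 hp
      _ = (N + 1) * ((1 + t * -((e : ℝ) / (D + e + 1))) * (D + e + 1) ^ t) := by ring
      _ ≤ (N + 1) * (D + 1) ^ t := by gcongr
  exact_mod_cast h3

theorem degreeOf_prod_X_sub_C_le (c : κ → K) (j : κ) :
    degreeOf j (∏ j', (X j' - C (c j')) : MvPolynomial κ K) ≤ 1 := by
  classical
  calc degreeOf j (∏ j', (X j' - C (c j')) : MvPolynomial κ K)
      ≤ ∑ j', degreeOf j (X j' - C (c j') : MvPolynomial κ K) := degreeOf_prod_le _ _ _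
    _ ≤ ∑ j', if j = j' then 1 else 0 := by
        refine Finset.sum_le_sum fun j' _ => (degreeOf_sub_le _ _ _).trans ?_
        simp [degreeOf_X, degreeOf_C]
    _ = 1 := by simp

theorem degreeOf_prodSubHom_monomial_le (a : ι → κ → K) (α : ι →₀ ℕ) (j : κ) :
    degreeOf j (prodSubHom a (monomial α 1)) ≤ ∑ i, α i := by
  rw [prodSubHom, aeval_monomial, map_one, one_mul, Finsupp.prod_fintype _ _ (by simp)]
  refine (degreeOf_prod_le _ _ _).trans (Finset.sum_le_sum fun i _ => ?_)
  refine (degreeOf_pow_le _ _ _).trans ?_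
  simpa using Nat.mul_le_mul_left (α i) (degreeOf_prod_X_sub_C_le (a i) j)

open Polynomial in
/-- The extension given by `prodSubHom a` has degree at most `t!`, where `t` is the number of
variables, in the sense that every `h` satisfies a nonzero polynomial relation of degree at most
`t!`. Such a relation is found among the combinations of `prodSubHom a m * h ^ i` with `i ≤ t!` and
`m` a monomial of total degree at most `D`, which for large `D` outnumber the monomials that can
occur in them. -/
theorem exists_polynomial_eval₂_prodSubHom_eq_zero (hcard : Fintype.card ι = Fintype.card κ)
    (a : ι → κ → K) (h : MvPolynomial κ K) :
    ∃ p : (MvPolynomial ι K)[X], p ≠ 0 ∧ p.natDegree ≤ (Fintype.card κ).factorial ∧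
      p.eval₂ (prodSubHom a).toRingHom h = 0 := by
  classical
  set t := Fintype.card κ with ht
  set N := t.factorial with hN
  set e := N * h.totalDegree with he
  obtain ⟨D, hD⟩ := exists_mul_add_pow_lt N e t
  -- Monomials of total degree at most `D` in the variables `ι`, homogenised by an extra variable.
  let T := Finset.finsuppAntidiag (Finset.univ : Finset (Option ι)) D
  have hTinj : ∀ τ ∈ T, ∀ τ' ∈ T, τ.some = τ'.some → τ = τ' := by
    intro τ hτ τ' hτ' hs
    have h1 := (Finset.mem_finsuppAntidiag.1 hτ).1
    have h2 := (Finset.mem_finsuppAntidiag.1 hτ').1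
    have h3 : ∀ i, τ (some i) = τ' (some i) := fun i => DFunLike.congr_fun hs i
    rw [Fintype.sum_option] at h1 h2
    simp only [h3] at h1
    ext o
    cases o with
    | none => omega
    | some i => exact h3 i
  have hTcard : N * T.card = (D + 1).ascFactorial t := by
    rw [Finset.card_finsuppAntidiag_nat_eq_choose, Nat.ascFactorial_eq_factorial_mul_choose,
      Finset.card_univ, Fintype.card_option, hcard, hN]
    congr 1
    rw [show t + 1 + D - 1 = D + t by omega, ← Nat.choose_symm_of_eq_add rfl]
  -- `Ψ c` evaluates the polynomial relation with coefficients `c` at `h`, and `Φ c` lists the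
  -- coefficients of `Ψ c` at the exponents allowed by `hdeg`.
  let Ψ : (Fin (N + 1) × T → K) →ₗ[K] MvPolynomial κ K :=
    Fintype.linearCombination K fun x => prodSubHom a (monomial x.2.1.some 1) * h ^ (x.1 : ℕ)
  have hdeg : ∀ c j, degreeOf j (Ψ c) ≤ D + e := by
    intro c j
    rw [Fintype.linearCombination_apply]
    refine (degreeOf_sum_le _ _ _).trans (Finset.sup_le fun x _ => ?_)
    rw [MvPolynomial.smul_eq_C_mul]
    refine (degreeOf_C_mul_le _ _ _).trans ((degreeOf_mul_le _ _ _).trans (add_le_add ?_ ?_))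
    · refine (degreeOf_prodSubHom_monomial_le a _ j).trans ?_
      have h1 := (Finset.mem_finsuppAntidiag.1 x.2.2).1
      rw [Fintype.sum_option] at h1
      simp only [Finsupp.some_apply]
      omega
    · refine (degreeOf_pow_le _ _ _).trans ?_
      exact Nat.mul_le_mul (Nat.lt_succ_iff.1 x.1.2) (degreeOf_le_totalDegree _ _)
  let Φ : (Fin (N + 1) × T → K) →ₗ[K] ((κ → Fin (D + e + 1)) → K) :=
    LinearMap.pi fun β =>
      (lcoeff K (Finsupp.equivFunOnFinite.symm fun j => (β j : ℕ))) ∘ₗ Ψ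
  have hker : LinearMap.ker Φ ≠ ⊥ := by
    apply LinearMap.ker_ne_bot_of_finrank_lt
    rw [Module.finrank_fintype_fun_eq_card, Module.finrank_fintype_fun_eq_card]
    simp only [Fintype.card_fun, Fintype.card_prod, Fintype.card_fin, Fintype.card_coe, ← ht]
    have hNpos : 0 < N := Nat.factorial_pos t
    refine lt_of_mul_lt_mul_left (a := N) ?_ (Nat.zero_le _)
    calc N * (D + e + 1) ^ t < (N + 1) * (D + 1) ^ t := hD
      _ ≤ (N + 1) * (D + 1).ascFactorial t := by
          gcongr; exact Nat.pow_succ_le_ascFactorial _ _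
      _ = N * ((N + 1) * T.card) := by rw [← hTcard]; ring
  obtain ⟨c, hc, hc0⟩ := Submodule.exists_mem_ne_zero_of_ne_bot hker
  have hΨ : Ψ c = 0 := by
    ext β
    rw [MvPolynomial.coeff_zero]
    by_cases hβ : ∀ j, β j ≤ D + e
    · have := congrFun (LinearMap.mem_ker.1 hc) fun j => ⟨β j, Nat.lt_succ_iff.2 (hβ j)⟩
      have hβ' : (Finsupp.equivFunOnFinite.symm fun j => β j) = β := by ext; simp
      simpa [Φ, hβ'] using this
    · push Not at hβ
      obtain ⟨j, hj⟩ := hβ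
      exact notMem_support_iff.1 (notMem_support_of_degreeOf_lt j ((hdeg c j).trans_lt hj))
  let P : Fin (N + 1) → MvPolynomial ι K := fun i =>
    ∑ τ : T, MvPolynomial.monomial τ.1.some (c (i, τ))
  refine ⟨∑ i : Fin (N + 1), Polynomial.monomial (i : ℕ) (P i), ?_, ?_, ?_⟩
  · intro h0
    apply hc0
    funext ⟨i, τ⟩
    have h1 := congrArg (fun p => MvPolynomial.coeff τ.1.some (Polynomial.coeff p i)) h0
    simp only [Polynomial.finsetSum_coeff, Polynomial.coeff_monomial, Fin.val_inj,
      Finset.sum_ite_eq', Finset.mem_univ, if_true, Polynomial.coeff_zero,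
      MvPolynomial.coeff_zero, P, MvPolynomial.coeff_sum, MvPolynomial.coeff_monomial] at h1
    rw [Finset.sum_eq_single τ] at h1
    · simpa using h1
    · intro τ' _ hne
      rw [if_neg]
      exact fun hs => hne (Subtype.ext (hTinj _ τ'.2 _ τ.2 hs))
    · simp
  · exact Polynomial.natDegree_sum_le_of_forall_le _ _ fun i _ =>
      (Polynomial.natDegree_monomial_le _).trans (Nat.lt_succ_iff.1 i.2)
  · rw [Polynomial.eval₂_finsetSum, ← hΨ, Fintype.linearCombination_apply, Fintype.sum_prod_type]
    refine Finset.sum_congr rfl fun i _ => ?_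
    rw [Polynomial.eval₂_monomial, map_sum, Finset.sum_mul]
    refine Finset.sum_congr rfl fun τ _ => ?_
    have : MvPolynomial.monomial τ.1.some (c (i, τ)) =
        c (i, τ) • (MvPolynomial.monomial τ.1.some 1 : MvPolynomial ι K) := by
      simp [MvPolynomial.smul_monomial]
    rw [this]
    show prodSubHom a _ * _ = _
    rw [map_smul, smul_mul_assoc]

/-- A system of `t` equations `∏ j, (x j - a i j) = b i` in `t` unknowns has at most `t!` solutions
over an infinite field, if the `a i j` are distinct in each column. -/
theorem card_le_factorial_of_forall_prod_sub_eq [Infinite K]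
    (hcard : Fintype.card ι = Fintype.card κ) (a : ι → κ → K)
    (ha : ∀ j, Function.Injective fun i => a i j) (b : ι → K) (S : Finset (κ → K))
    (hS : ∀ x ∈ S, ∀ i, ∏ j, (x j - a i j) = b i) :
    S.card ≤ (Fintype.card κ).factorial := by
  classical
  -- A linear form `f` that separates the points of `S`, written as the polynomial `h`.
  obtain ⟨f, hf⟩ := Module.exists_dual_forall_apply_ne_zero (K := K)
    (fun z : {z : S × S // z.1 ≠ z.2} => (z.1.1.1 - z.1.2.1 : κ → K))
    fun z => sub_ne_zero.2 fun h => z.2 (Subtype.ext h)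
  let h : MvPolynomial κ K := ∑ j, C (f fun j' => if j = j' then 1 else 0) * X j
  have hh : ∀ x : κ → K, eval x h = f x := by
    intro x
    rw [LinearMap.pi_apply_eq_sum_univ f x]
    simp [h, mul_comm]
  have hinj : Set.InjOn (fun x => eval x h) S := by
    intro x hx y hy hxy
    by_contra hne
    apply hf ⟨(⟨x, hx⟩, ⟨y, hy⟩), fun h => hne (congrArg Subtype.val h)⟩
    rw [map_sub, sub_eq_zero, ← hh, ← hh]
    exact hxy
  let _ : Algebra (MvPolynomial ι K) (MvPolynomial κ K) := (prodSubHom a).toRingHom.toAlgebra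
  have hfaith : FaithfulSMul (MvPolynomial ι K) (MvPolynomial κ K) :=
    (faithfulSMul_iff_algebraMap_injective _ _).2 (prodSubHom_injective hcard a ha)
  have hint : IsIntegral (MvPolynomial ι K) h := prodSubHom_isIntegral hcard.ge a ha h
  let m := minpoly (MvPolynomial ι K) h
  obtain ⟨p, hp0, hpdeg, hp⟩ := exists_polynomial_eval₂_prodSubHom_eq_zero hcard a h
  have hmdeg : m.natDegree ≤ (Fintype.card κ).factorial :=
    (Polynomial.natDegree_le_natDegree
      (minpoly.IsIntegrallyClosed.degree_le_of_ne_zero hp0 hp)).trans hpdeg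
  have hmonic : (m.map (eval b)).Monic := (minpoly.monic hint).map _
  have hroot : ∀ x ∈ S, eval x h ∈ (m.map (eval b)).roots := by
    intro x hx
    rw [Polynomial.mem_roots hmonic.ne_zero, Polynomial.IsRoot, Polynomial.eval_map]
    -- Evaluating at a solution `x` specialises the coefficients at `b`.
    have hcomp : (eval x).comp (prodSubHom a).toRingHom = eval b := by
      apply MvPolynomial.ringHom_ext
      · intro r
        simp [prodSubHom]
      · intro i
        simp [prodSubHom, hS x hx i]
    rw [← hcomp, ← Polynomial.hom_eval₂]
    have : m.eval₂ (prodSubHom a).toRingHom h = 0 := minpoly.aeval _ h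
    rw [this, map_zero]
  calc S.card = (S.image fun x => eval x h).card := (Finset.card_image_of_injOn hinj).symm
    _ ≤ (m.map (eval b)).roots.toFinset.card :=
        Finset.card_le_card fun y hy => by
          obtain ⟨x, hx, rfl⟩ := Finset.mem_image.1 hy
          exact Multiset.mem_toFinset.2 (hroot x hx)
    _ ≤ (m.map (eval b)).roots.card := Multiset.toFinset_card_le _
    _ ≤ (m.map (eval b)).natDegree := Polynomial.card_roots' _
    _ ≤ m.natDegree := Polynomial.natDegree_map_le
    _ ≤ _ := hmdeg

end Algebra

/-! ### The projective norm graph -/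

/-- The projective norm graph of a field extension `E / F`: vertices `(A, a)` and `(B, b)` in `E × Fˣ`
are adjacent when they are distinct and the norm of `A + B` is `a * b`. -/
def projNormGraph (F E : Type*) [Field F] [Field E] [Algebra F E] : SimpleGraph (E × Fˣ) where
  Adj x y := x ≠ y ∧ Algebra.norm F (x.1 + y.1) = x.2 * y.2
  symm := ⟨fun x y h => ⟨h.1.symm, by rw [add_comm, h.2, mul_comm]⟩⟩
  loopless := ⟨fun _ h => h.1 rfl⟩

/-- In the projective norm graph of an extension of degree `d`, any `d + 1` vertices have at most
`d!` common neighbours. Fix one of the vertices, `(A₀, a₀)`. For a common neighbour `(X, x)`, put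
`Y = (X + A₀)⁻¹`. Dividing the adjacency equation of `(A, a)` by that of `(A₀, a₀)` shows that
`Y + (A - A₀)⁻¹` has prescribed norm. Writing norms as products over the embeddings into an
algebraic closure turns this into a system of `d` equations for the `d` conjugates of `Y`. -/
theorem card_le_factorial_of_isCompleteBetween_projNormGraph {F E : Type*} [Field F] [Field E]
    [Algebra F E] [FiniteDimensional F E] [Algebra.IsSeparable F E] {L R : Finset (E × Fˣ)}
    (hL : L.card = Module.finrank F E + 1) (h : (projNormGraph F E).IsCompleteBetween L R) :
    R.card ≤ (Module.finrank F E).factorial := by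
  classical
  obtain rfl | ⟨r₀, hr₀⟩ := R.eq_empty_or_nonempty
  · simp
  have hadj : ∀ l ∈ L, ∀ r ∈ R, Algebra.norm F (r.1 + l.1) = r.2 * l.2 := fun l hl r hr => by
    rw [add_comm, (h hl hr).2, mul_comm]
  have hne : ∀ l ∈ L, ∀ r ∈ R, r.1 + l.1 ≠ 0 := fun l hl r hr h0 => by
    have := hadj l hl r hr
    rw [h0, Algebra.norm_zero] at this
    exact (r.2 * l.2).ne_zero (by simpa using this.symm)
  have hLinj : ∀ l ∈ L, ∀ l' ∈ L, l.1 = l'.1 → l = l' := fun l hl l' hl' hll' => by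
    refine Prod.ext hll' (Units.ext (mul_left_cancel₀ r₀.2.ne_zero ?_))
    rw [← hadj l hl r₀ hr₀, ← hadj l' hl' r₀ hr₀, hll']
  obtain ⟨l₀, hl₀⟩ : L.Nonempty := Finset.card_pos.1 (by omega)
  have hsub : ∀ i ∈ L.erase l₀, i.1 - l₀.1 ≠ 0 := fun i hi h0 =>
    (Finset.mem_erase.1 hi).1 (hLinj _ (Finset.mem_erase.1 hi).2 _ hl₀ (sub_eq_zero.1 h0))
  let Ω := AlgebraicClosure F
  have hcard : Fintype.card (L.erase l₀) = Fintype.card (E →ₐ[F] Ω) := by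
    rw [Fintype.card_coe, Finset.card_erase_of_mem hl₀, hL, AlgHom.card,
      Nat.add_sub_cancel]
  let ψ : E × Fˣ → ((E →ₐ[F] Ω) → Ω) := fun r σ => σ (r.1 + l₀.1)⁻¹
  have hψ : Set.InjOn ψ R := by
    intro r hr r' hr' hrr'
    have σ : E →ₐ[F] Ω := IsAlgClosed.lift
    have h1 := inv_injective (σ.injective (congrFun hrr' σ))
    have h2 : r.1 = r'.1 := add_right_cancel h1
    refine Prod.ext h2 (Units.ext (mul_right_cancel₀ l₀.2.ne_zero ?_))
    rw [← hadj l₀ hl₀ r hr, ← hadj l₀ hl₀ r' hr', h2]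
  have key := card_le_factorial_of_forall_prod_sub_eq hcard
    (fun i σ => -σ (i.1.1 - l₀.1)⁻¹) ?_
    (fun i => algebraMap F Ω (i.1.2 / (l₀.2 * Algebra.norm F (i.1.1 - l₀.1)))) (R.image ψ) ?_
  · rw [Finset.card_image_of_injOn hψ, ← hcard, Fintype.card_coe, Finset.card_erase_of_mem hl₀,
      hL] at key
    exact key
  · intro σ i i' hii'
    have h1 := sub_left_injective (inv_injective (σ.injective (neg_injective hii')))
    exact Subtype.ext
      (hLinj _ (Finset.mem_erase.1 i.2).2 _ (Finset.mem_erase.1 i'.2).2 h1)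
  · intro x hx i
    obtain ⟨r, hr, rfl⟩ := Finset.mem_image.1 hx
    have hi := (Finset.mem_erase.1 i.2).2
    have e1 : (r.1 + l₀.1)⁻¹ + (i.1.1 - l₀.1)⁻¹ =
        (r.1 + i.1.1) / ((r.1 + l₀.1) * (i.1.1 - l₀.1)) := by
      have := hne l₀ hl₀ r hr
      have := hsub i.1 i.2
      field_simp
      ring
    have e2 : Algebra.norm F ((r.1 + l₀.1)⁻¹ + (i.1.1 - l₀.1)⁻¹) =
        i.1.2 / (l₀.2 * Algebra.norm F (i.1.1 - l₀.1)) := by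
      have h0 : (r.1 + l₀.1) * (i.1.1 - l₀.1) ≠ 0 := mul_ne_zero (hne l₀ hl₀ r hr) (hsub i.1 i.2)
      have h1 := (Algebra.norm_ne_zero_iff (R := F)).2 h0
      rw [← mul_div_mul_left _ _ r.2.ne_zero, ← hadj _ hi r hr, ← mul_assoc, ← hadj _ hl₀ r hr,
        ← map_mul, eq_div_iff h1, ← map_mul, e1, div_mul_cancel₀ _ h0]
    rw [← e2, Algebra.norm_eq_prod_embeddings]
    refine Finset.prod_congr rfl fun σ _ => ?_
    simp [ψ]

open Classical in
/-- In characteristic two, each three-element subset of `E` is the projection of a triangle of the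
projective norm graph, because every element of `F` is a square. -/
theorem choose_le_card_cliqueFinset_projNormGraph {F E : Type*} [Field F] [Field E]
    [Algebra F E] [Fintype F] [Fintype E] [CharP F 2] :
    (Fintype.card E).choose 3 ≤ ((projNormGraph F E).cliqueFinset 3).card := by
  have : CharP E 2 := charP_of_injective_algebraMap (algebraMap F E).injective 2
  have hN : ∀ A B : E, A ≠ B → Algebra.norm F (A + B) ≠ 0 := fun A B hAB h0 => hAB (by
    rwa [Algebra.norm_eq_zero_iff, CharTwo.add_eq_zero] at h0)
  rw [← Finset.card_univ, ← Finset.card_powersetCard]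
  refine le_trans (Finset.card_le_card ?_)
    (Finset.card_image_le (f := fun C : Finset (E × Fˣ) => C.image Prod.fst))
  intro S hS
  obtain ⟨A, B, C, hAB, hAC, hBC, rfl⟩ := Finset.card_eq_three.1 (Finset.mem_powersetCard.1 hS).2
  let u := Units.mk0 _ (hN A B hAB)
  let v := Units.mk0 _ (hN A C hAC)
  let w := Units.mk0 _ (hN B C hBC)
  obtain ⟨a, ha⟩ : ∃ a : Fˣ, a ^ 2 = u * v / w := by
    obtain ⟨a, ha⟩ := (bijective_frobenius F 2).2 (u * v / w : Fˣ)
    rw [frobenius_def] at ha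
    have ha0 : a ≠ 0 := by
      rintro rfl
      exact (u * v / w).ne_zero (by simpa using ha.symm)
    exact ⟨Units.mk0 a ha0, Units.ext (by simpa using ha)⟩
  -- The first two edges determine the other labels, and the third edge holds as `a ^ 2 = u * v / w`.
  refine Finset.mem_image.2 ⟨{(A, a), (B, u / a), (C, v / a)}, ?_, by simp⟩
  rw [SimpleGraph.mem_cliqueFinset_iff, SimpleGraph.is3Clique_triple_iff]
  have huv : ∀ x : Fˣ, a * (x / a) = x := fun x => mul_div_cancel a x
  refine ⟨⟨fun h => hAB (congrArg Prod.fst h), ?_⟩, ⟨fun h => hAC (congrArg Prod.fst h), ?_⟩,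
    ⟨fun h => hBC (congrArg Prod.fst h), ?_⟩⟩
  · exact (congrArg Units.val (huv u)).symm
  · exact (congrArg Units.val (huv v)).symm
  · have : u / a * (v / a) = w := by
      rw [div_mul_div_comm, ← pow_two, ha, div_div_cancel]
    exact (congrArg Units.val this).symm

open Classical in
theorem card_cliqueFinset_le_copyCount {V : Type*} [Fintype V] (G : SimpleGraph V) (r : ℕ) :
    (G.cliqueFinset r).card ≤ G.copyCount (SimpleGraph.completeGraph (Fin r)) := by
  rw [SimpleGraph.copyCount]
  refine Finset.card_le_card_of_injOn (fun S => (⊤ : G.Subgraph).induce (S : Set V)) ?_ ?_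
  · intro S hS
    obtain ⟨hcl, hcard⟩ := (SimpleGraph.mem_cliqueFinset_iff.1 hS)
    rw [Finset.mem_coe, Finset.mem_filter]
    refine ⟨Finset.mem_univ _, ⟨⟨(S.equivFinOfCardEq hcard).symm, ?_⟩⟩⟩
    intro i j
    simp only [SimpleGraph.Subgraph.coe_adj, SimpleGraph.Subgraph.induce_adj]
    constructor
    · rintro h rfl
      exact G.loopless.irrefl _ h.2.2
    · intro hij
      refine ⟨Subtype.prop _, Subtype.prop _, hcl (Subtype.prop _) (Subtype.prop _) ?_⟩
      intro he
      exact hij ((S.equivFinOfCardEq hcard).symm.injective (Subtype.ext he))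
  · intro S _ S' _ h
    have := congrArg SimpleGraph.Subgraph.verts h
    simpa using this

/-- If `H` has no isolated vertices, then isolated vertices of the host graph are irrelevant for
containing `H`. -/
theorem isContained_of_isContained_map {V V' W : Type*} {G : SimpleGraph V} {H : SimpleGraph W}
    (e : V ↪ V') (hH : ∀ w, ∃ w', H.Adj w w') (h : H.IsContained (G.map e)) : H.IsContained G := by
  obtain ⟨f⟩ := h
  have hf : ∀ w, ∃ v, e v = f w := by
    intro w
    obtain ⟨w', hw⟩ := hH w
    obtain ⟨-, u, -, -, hu, -⟩ := f.toHom.map_adj hw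
    exact ⟨u, hu⟩
  choose g hg using hf
  refine ⟨⟨⟨g, ?_⟩, ?_⟩⟩
  · intro w w' hww
    have := f.toHom.map_adj hww
    rw [SimpleGraph.Copy.toHom_apply, SimpleGraph.Copy.toHom_apply, ← hg, ← hg,
      SimpleGraph.map_adj_apply] at this
    exact this
  · intro w w' hww
    apply f.injective
    have : g w = g w' := hww
    rw [SimpleGraph.Copy.toHom_apply, SimpleGraph.Copy.toHom_apply, ← hg, ← hg, this]

/-! ### The lower bound -/

open Classical in
/-- The triangle count of the projective norm graph over the field with `2 ^ k` elements, padded with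
isolated vertices. -/
theorem choose_le_generalizedExtremalNumber {s t n k : ℕ} (hs : 2 ≤ s)
    (ht : (s - 1).factorial + 1 ≤ t) (hk : k ≠ 0) (hn : (2 ^ k) ^ s ≤ n) :
    ((2 ^ k) ^ (s - 1)).choose 3 ≤ generalizedExtremalNumber n
      (SimpleGraph.completeGraph (Fin 3)) (completeBipartiteGraph (Fin s) (Fin t)) := by
  let F := GaloisField 2 k
  have : NeZero (s - 1) := ⟨by omega⟩
  let E := FiniteField.Extension F 2 (s - 1)
  let _ : Fintype F := Fintype.ofFinite F
  let _ : Fintype E := Fintype.ofFinite E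
  have hF : Fintype.card F = 2 ^ k := by
    rw [← Nat.card_eq_fintype_card, GaloisField.card 2 k hk]
  have hE : Fintype.card E = (2 ^ k) ^ (s - 1) := by
    rw [← hF, ← Nat.card_eq_fintype_card, ← Nat.card_eq_fintype_card]
    exact FiniteField.natCard_extension F 2 (s - 1)
  have hrank : Module.finrank F E = s - 1 := FiniteField.finrank_extension F 2 (s - 1)
  have hV : Fintype.card (E × Fˣ) ≤ Fintype.card (Fin n) := by
    rw [Fintype.card_prod, Fintype.card_fin, hE]
    refine le_trans ?_ hn
    calc (2 ^ k) ^ (s - 1) * Fintype.card Fˣ ≤ (2 ^ k) ^ (s - 1) * 2 ^ k := by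
          gcongr
          rw [← hF]
          exact Fintype.card_le_of_injective _ Units.val_injective
      _ = (2 ^ k) ^ s := by rw [← pow_succ, Nat.sub_add_cancel (by omega)]
  obtain ⟨e⟩ := Function.Embedding.nonempty_of_card_le hV
  have hfree : (completeBipartiteGraph (Fin s) (Fin t)).Free ((projNormGraph F E).map e) := by
    intro hcon
    have hcon' := isContained_of_isContained_map e (fun w => ?_) hcon
    · obtain ⟨L, R, hL, hR, hLR⟩ := SimpleGraph.completeBipartiteGraph_isContained_iff.1 hcon'
      rw [Fintype.card_fin] at hL hR
      have := card_le_factorial_of_isCompleteBetween_projNormGraph (by rw [hL, hrank]; omega) hLR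
      rw [hrank] at this
      omega
    · rcases w with x | y
      · exact ⟨Sum.inr ⟨0, by omega⟩, by simp⟩
      · exact ⟨Sum.inl ⟨0, by omega⟩, by simp⟩
  calc ((2 ^ k) ^ (s - 1)).choose 3 ≤ ((projNormGraph F E).cliqueFinset 3).card := by
        rw [← hE]; exact choose_le_card_cliqueFinset_projNormGraph
    _ = (((projNormGraph F E).map e).cliqueFinset 3).card := by
        rw [SimpleGraph.cliqueFinset_map _ e (by norm_num), Finset.card_map]
    _ ≤ ((projNormGraph F E).map e).copyCount (SimpleGraph.completeGraph (Fin 3)) := by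
        convert card_cliqueFinset_le_copyCount _ 3
    _ ≤ _ := by
        rw [generalizedExtremalNumber]
        exact Finset.le_sup (f := fun G => SimpleGraph.copyCount G _)
          (Finset.mem_filter.2 ⟨Finset.mem_univ _, hfree⟩)

theorem rpow_le_generalizedExtremalNumber {s t : ℕ} (hs : 2 ≤ s)
    (ht : (s - 1).factorial + 1 ≤ t) : ∃ c : ℝ, 0 < c ∧ ∀ n : ℕ, (2 ^ 2) ^ s ≤ n →
      c * (n : ℝ) ^ (3 - 3 / (s : ℝ)) ≤ generalizedExtremalNumber n
        (SimpleGraph.completeGraph (Fin 3)) (completeBipartiteGraph (Fin s) (Fin t)) := by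
  refine ⟨(27 * (2 : ℝ) ^ (3 * (s - 1)))⁻¹, by positivity, fun n hn => ?_⟩
  have hn0 : n ≠ 0 := by
    rintro rfl
    exact absurd hn (by simp)
  -- The largest `k` with `(2 ^ k) ^ s ≤ n`.
  set k := Nat.log 2 n / s with hk
  have hks : k * s ≤ Nat.log 2 n := Nat.div_mul_le_self _ _
  have hks' : Nat.log 2 n < (k + 1) * s := by
    rw [hk, ← Nat.div_lt_iff_lt_mul (by omega)]; exact Nat.lt_succ_self _
  have hk2 : 2 ≤ k := by
    rw [hk, Nat.le_div_iff_mul_le (by omega), Nat.le_log_iff_pow_le (by norm_num) hn0, pow_mul]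
    exact hn
  have hkn : (2 ^ k) ^ s ≤ n := by
    rw [← pow_mul]
    exact (Nat.pow_le_pow_right (by norm_num) hks).trans (Nat.pow_log_le_self 2 hn0)
  have hnk : n ≤ (2 ^ (k + 1)) ^ s := by
    rw [← pow_mul]
    exact ((Nat.lt_pow_succ_log_self (by norm_num) n).trans_le
      (Nat.pow_le_pow_right (by norm_num) hks')).le
  refine le_trans ?_ (Nat.cast_le.2 (choose_le_generalizedExtremalNumber hs ht (by omega) hkn))
  set m := (2 ^ k) ^ (s - 1) with hm
  have hm3 : 4 ≤ m := by
    calc 4 = (2 ^ 2) ^ 1 := by norm_num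
      _ ≤ (2 ^ k) ^ 1 := by gcongr; norm_num
      _ ≤ m := Nat.pow_le_pow_right (by positivity) (by omega)
  have hs0 : (0 : ℝ) < s := by positivity
  have h1 : (n : ℝ) ^ (3 - 3 / (s : ℝ)) ≤ (2 : ℝ) ^ (3 * (s - 1)) * (m : ℝ) ^ 3 := by
    have hexp : 0 ≤ 3 - 3 / (s : ℝ) := by
      rw [sub_nonneg, div_le_iff₀ hs0]
      have : (2 : ℝ) ≤ s := by exact_mod_cast hs
      linarith
    calc (n : ℝ) ^ (3 - 3 / (s : ℝ)) ≤ (((2 : ℝ) ^ (k + 1)) ^ s) ^ (3 - 3 / (s : ℝ)) := by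
          refine Real.rpow_le_rpow (by positivity) ?_ hexp
          exact_mod_cast hnk
      _ = ((2 : ℝ) ^ (k + 1)) ^ (3 * (s - 1)) := by
          rw [← Real.rpow_natCast, ← Real.rpow_mul (by positivity), ← Real.rpow_natCast (_ ^ _)]
          congr 1
          rw [Nat.cast_mul, Nat.cast_sub (by omega)]
          push_cast
          field_simp
      _ = (2 : ℝ) ^ (3 * (s - 1)) * (m : ℝ) ^ 3 := by
          rw [hm]; push_cast
          ring
  have h2 : (m : ℝ) ^ 3 ≤ 27 * (m.choose 3 : ℝ) := by
    have h3 : m.descFactorial 3 = 6 * m.choose 3 := Nat.descFactorial_eq_factorial_mul_choose m 3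
    have h4 : (m.descFactorial 3 : ℝ) = m * (m - 1) * (m - 2) := by
      rw [Nat.descFactorial_succ, Nat.descFactorial_succ, Nat.descFactorial_succ,
        Nat.descFactorial_zero]
      push_cast [Nat.cast_sub (show 2 ≤ m by omega), Nat.cast_sub (show 1 ≤ m by omega), Nat.sub_zero]
      ring
    have h5 : (m.descFactorial 3 : ℝ) = 6 * m.choose 3 := by exact_mod_cast h3
    have h6 : (4 : ℝ) ≤ m := by exact_mod_cast hm3
    have h7 : (27 : ℝ) * m.choose 3 = 27 / 6 * (m * (m - 1) * (m - 2)) := by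
      rw [← h4, h5]; ring
    rw [h7]
    nlinarith [mul_nonneg (sub_nonneg.2 h6) (sub_nonneg.2 h6)]
  rw [inv_mul_le_iff₀ (by positivity)]
  calc (n : ℝ) ^ (3 - 3 / (s : ℝ)) ≤ (2 : ℝ) ^ (3 * (s - 1)) * (m : ℝ) ^ 3 := h1
    _ ≤ (2 : ℝ) ^ (3 * (s - 1)) * (27 * (m.choose 3 : ℝ)) := by gcongr
    _ = _ := by ring

/-! ### The upper bound -/

/-- Double counting of the pairs `(w, S)` with `w ∈ W` and `S` a `k`-subset of `D` all of whose
elements are related to `w`. -/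
theorem sum_choose_card_filter_le {V : Type*} [DecidableEq V] (W D : Finset V) (r : V → V → Prop)
    [DecidableRel r] (k T : ℕ)
    (h : ∀ S ⊆ D, S.card = k → ∀ R ⊆ W, (∀ w ∈ R, ∀ x ∈ S, r w x) → R.card ≤ T) :
    ∑ w ∈ W, (D.filter fun x => r w x).card.choose k ≤ T * D.card.choose k := by
  calc ∑ w ∈ W, (D.filter fun x => r w x).card.choose k
      = ∑ w ∈ W, ((D.powersetCard k).bipartiteAbove (fun w S => ∀ x ∈ S, r w x) w).card := by
        refine Finset.sum_congr rfl fun w _ => ?_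
        rw [← Finset.card_powersetCard]
        congr 1
        ext S
        simp only [Finset.mem_powersetCard, Finset.mem_bipartiteAbove, Finset.subset_iff,
          Finset.mem_filter]
        grind
    _ = ∑ S ∈ D.powersetCard k, (W.bipartiteBelow (fun w S => ∀ x ∈ S, r w x) S).card :=
        Finset.sum_card_bipartiteAbove_eq_sum_card_bipartiteBelow _
    _ ≤ ∑ S ∈ D.powersetCard k, T := Finset.sum_le_sum fun S hS =>
        h S (Finset.mem_powersetCard.1 hS).1 (Finset.mem_powersetCard.1 hS).2 _
          (Finset.filter_subset _ _) fun _ hw => (Finset.mem_filter.1 hw).2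
    _ = T * D.card.choose k := by
        rw [Finset.sum_const, Finset.card_powersetCard, smul_eq_mul, mul_comm]

theorem pow_le_mul_one_add_choose (c k : ℕ) :
    c ^ k ≤ k ^ k * k.factorial * (1 + c.choose k) := by
  have hf := k.factorial_pos
  obtain h | h := le_total c k
  · calc c ^ k ≤ k ^ k := Nat.pow_le_pow_left h k
      _ ≤ k ^ k * (k.factorial * (1 + c.choose k)) := Nat.le_mul_of_pos_right _ (by positivity)
      _ = _ := (mul_assoc _ _ _).symm
  · obtain rfl | hk := k.eq_zero_or_pos
    · simp
    -- With no truncation, as `k ≤ c`: the difference of the two sides is `(k - 1) * (c - k)`.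
    have hc : c ≤ k * (c + 1 - k) := by
      obtain ⟨m, rfl⟩ := Nat.exists_eq_add_of_le h
      rw [show k + m + 1 - k = m + 1 by omega]
      nlinarith
    calc c ^ k ≤ (k * (c + 1 - k)) ^ k := Nat.pow_le_pow_left hc k
      _ = k ^ k * (c + 1 - k) ^ k := mul_pow _ _ _
      _ ≤ k ^ k * c.descFactorial k := by gcongr; exact Nat.pow_sub_le_descFactorial c k
      _ = k ^ k * k.factorial * c.choose k := by
          rw [Nat.descFactorial_eq_factorial_mul_choose, mul_assoc]
      _ ≤ _ := by gcongr; omega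

/-- Interpolation between the powers of `x` at scale `D`. -/
theorem pow_mul_pow_le_add {x D : ℝ} (hx : 0 ≤ x) (hD : 0 ≤ D) (a e : ℕ) :
    x ^ a * D ^ e ≤ D ^ (a + e) + x ^ (a + e) := by
  obtain h | h := le_total x D
  · calc x ^ a * D ^ e ≤ D ^ a * D ^ e := by gcongr
      _ = D ^ (a + e) := (pow_add _ _ _).symm
      _ ≤ _ := le_add_of_nonneg_right (by positivity)
  · calc x ^ a * D ^ e ≤ x ^ a * x ^ e := by gcongr
      _ = x ^ (a + e) := (pow_add _ _ _).symm
      _ ≤ _ := le_add_of_nonneg_left (by positivity)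

open Classical in
/-- The number of triangles is at most the sum of the codegrees of the directed edges. -/
theorem copyCount_completeGraph_three_le {V : Type*} [Fintype V] (G : SimpleGraph V) :
    G.copyCount (SimpleGraph.completeGraph (Fin 3)) ≤
      ∑ v, ∑ w ∈ G.neighborFinset v, ((G.neighborFinset v).filter fun x => G.Adj w x).card := by
  refine G.copyCount_le_labelledCopyCount.trans ?_
  simp_rw [← Finset.card_sigma]
  suffices key : ∀ T : Finset (SimpleGraph.Copy (SimpleGraph.completeGraph (Fin 3)) G),
      T.card ≤ _ by
    exact key _
  intro T
  refine Finset.card_le_card_of_injOn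
    (fun f => (⟨f (0 : Fin 3), f (1 : Fin 3), f (2 : Fin 3)⟩ : Σ _ : V, Σ _ : V, V)) ?_ ?_
  · intro f _
    have hadj : ∀ i j : Fin 3, i ≠ j → G.Adj (f i) (f j) := fun i j hij => f.toHom.map_adj hij
    simp [hadj]
  · intro f _ g _ hfg
    simp only [Sigma.mk.injEq, heq_eq_eq] at hfg
    ext i
    fin_cases i
    · exact hfg.1
    · exact hfg.2.1
    · exact hfg.2.2

theorem card_lt_of_free_of_forall_adj {V : Type*} {G : SimpleGraph V} {s t : ℕ}
    (hG : (completeBipartiteGraph (Fin s) (Fin t)).Free G) {S R : Finset V} (hS : S.card = s)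
    (h : ∀ w ∈ R, ∀ x ∈ S, G.Adj w x) : R.card < t := by
  by_contra! hR
  obtain ⟨R', hR', hRt⟩ := Finset.exists_subset_card_eq hR
  exact hG (SimpleGraph.completeBipartiteGraph_isContained_iff.2
    ⟨S, R', by simpa using hS, by simpa using hRt, fun x hx w hw => (h w (hR' hw) x hx).symm⟩)

open Classical in
theorem sum_degree_pow_le {V : Type*} [Fintype V] {G : SimpleGraph V} {s t : ℕ} (hs : s ≠ 0)
    (hG : (completeBipartiteGraph (Fin s) (Fin t)).Free G) :
    ∑ v, G.degree v ^ s ≤ s ^ s * s.factorial * (1 + t) * Fintype.card V ^ s := by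
  calc ∑ v, G.degree v ^ s
      ≤ ∑ v, s ^ s * s.factorial * (1 + (G.degree v).choose s) :=
        Finset.sum_le_sum fun v _ => pow_le_mul_one_add_choose _ _
    _ = s ^ s * s.factorial * (Fintype.card V + ∑ v, (G.degree v).choose s) := by
        rw [← Finset.mul_sum, Finset.sum_add_distrib]; simp
    _ ≤ s ^ s * s.factorial * (Fintype.card V ^ s + t * Fintype.card V ^ s) := by
        gcongr
        · exact Nat.le_self_pow hs _
        · have h := sum_choose_card_filter_le (Finset.univ : Finset V) Finset.univ G.Adj s t
            fun S _ hS R _ hR => (card_lt_of_free_of_forall_adj hG hS hR).le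
          simp_rw [← SimpleGraph.neighborFinset_eq_filter, SimpleGraph.card_neighborFinset_eq_degree]
            at h
          refine h.trans ?_
          gcongr
          exact Nat.choose_le_pow _ _
    _ = _ := by ring

open Classical in
/-- In a `K_{k+1,t}`-free graph the neighbourhood of `v` induces a `K_{k,t}`-free graph, as `v` may be
added to the side of size `k`. This bounds the `k`-th powers of the codegrees of the edges at `v`. -/
theorem sum_codegree_pow_le {V : Type*} [Fintype V] {G : SimpleGraph V} {k t : ℕ} (hk : k ≠ 0)
    (hG : (completeBipartiteGraph (Fin (k + 1)) (Fin t)).Free G) (v : V) :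
    ∑ w ∈ G.neighborFinset v, ((G.neighborFinset v).filter fun x => G.Adj w x).card ^ k ≤
      k ^ k * k.factorial * (1 + t) * G.degree v ^ k := by
  calc ∑ w ∈ G.neighborFinset v, ((G.neighborFinset v).filter fun x => G.Adj w x).card ^ k
      ≤ ∑ w ∈ G.neighborFinset v, k ^ k * k.factorial *
          (1 + ((G.neighborFinset v).filter fun x => G.Adj w x).card.choose k) :=
        Finset.sum_le_sum fun w _ => pow_le_mul_one_add_choose _ _
    _ = k ^ k * k.factorial * (G.degree v + ∑ w ∈ G.neighborFinset v,
          ((G.neighborFinset v).filter fun x => G.Adj w x).card.choose k) := by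
        rw [← Finset.mul_sum, Finset.sum_add_distrib]; simp
    _ ≤ k ^ k * k.factorial * (G.degree v ^ k + t * G.degree v ^ k) := by
        gcongr
        · exact Nat.le_self_pow hk _
        · refine (sum_choose_card_filter_le (G.neighborFinset v) (G.neighborFinset v) G.Adj k t
            fun S hSv hS R hRv hR => ?_).trans ?_
          · have hvS : v ∉ S := fun hv => by simpa using hSv hv
            refine (card_lt_of_free_of_forall_adj hG (S := insert v S) (R := R)
              (by rw [Finset.card_insert_of_notMem hvS, hS]) fun w hw x hx => ?_).le
            obtain rfl | hx := Finset.mem_insert.1 hx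
            · exact ((SimpleGraph.mem_neighborFinset _ _ _).1 (hRv hw)).symm
            · exact hR w hw x hx
          · rw [SimpleGraph.card_neighborFinset_eq_degree]
            gcongr
            exact Nat.choose_le_pow _ _
    _ = _ := by ring

open Classical in
/-- The upper bound on the number of triangles in a `K_{s,t}`-free graph, with `s = j + 2` and the
number of vertices written as `r ^ s`, which makes all exponents natural numbers: degrees have
scale `r ^ (j + 1)`, codegrees scale `r ^ j`, and the bound is `O(r ^ (3 * j + 3))`. -/
theorem copyCount_completeGraph_three_le_of_free (j t : ℕ) : ∃ M : ℝ, ∀ (n : ℕ) (r : ℝ), 0 < r →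
    (n : ℝ) = r ^ (j + 2) → ∀ G : SimpleGraph (Fin n),
    (completeBipartiteGraph (Fin (j + 2)) (Fin t)).Free G →
    (G.copyCount (SimpleGraph.completeGraph (Fin 3)) : ℝ) ≤ M * r ^ (3 * j + 3) := by
  set C₁ : ℕ := (j + 2) ^ (j + 2) * (j + 2).factorial * (1 + t)
  set C₂ : ℕ := (j + 1) ^ (j + 1) * (j + 1).factorial * (1 + t)
  refine ⟨(1 + C₁) * (1 + C₂), fun n r hr hn G hG => ?_⟩
  let c : Fin n → Fin n → ℕ := fun v w => ((G.neighborFinset v).filter fun x => G.Adj w x).card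
  have hds : ∑ v, (G.degree v : ℝ) ^ (j + 2) ≤ C₁ * (n : ℝ) ^ (j + 2) := by
    have := sum_degree_pow_le (by omega) hG
    rw [Fintype.card_fin] at this
    exact_mod_cast this
  have hcs : ∑ v, ∑ w ∈ G.neighborFinset v, (c v w : ℝ) ^ (j + 1) ≤
      C₂ * ∑ v, (G.degree v : ℝ) ^ (j + 1) := by
    rw [Finset.mul_sum]
    refine Finset.sum_le_sum fun v _ => ?_
    have := sum_codegree_pow_le (by omega) hG v
    exact_mod_cast this
  have htot : (n : ℝ) * (r ^ (j + 1)) ^ (j + 2) + C₁ * (n : ℝ) ^ (j + 2) =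
      (1 + C₁) * (r ^ (j + 2)) ^ (j + 2) := by
    rw [hn]; ring
  have hd1 : (∑ v, (G.degree v : ℝ)) ≤ (1 + C₁) * r ^ (2 * j + 3) := by
    refine le_of_mul_le_mul_right ?_ (show (0 : ℝ) < (r ^ (j + 1)) ^ (j + 1) by positivity)
    calc (∑ v, (G.degree v : ℝ)) * (r ^ (j + 1)) ^ (j + 1)
        ≤ ∑ v, ((r ^ (j + 1)) ^ (j + 2) + (G.degree v : ℝ) ^ (j + 2)) := by
          rw [Finset.sum_mul]
          refine Finset.sum_le_sum fun v _ => ?_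
          have := pow_mul_pow_le_add (Nat.cast_nonneg (G.degree v)) (pow_nonneg hr.le (j + 1))
            1 (j + 1)
          rwa [pow_one, show 1 + (j + 1) = j + 2 by ring] at this
      _ ≤ (1 + C₁) * (r ^ (j + 2)) ^ (j + 2) := by
          rw [Finset.sum_add_distrib, ← htot]
          simpa using hds
      _ = _ := by ring
  have hdk : (∑ v, (G.degree v : ℝ) ^ (j + 1)) ≤ (1 + C₁) * r ^ (j ^ 2 + 3 * j + 3) := by
    refine le_of_mul_le_mul_right ?_ (show (0 : ℝ) < r ^ (j + 1) by positivity)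
    calc (∑ v, (G.degree v : ℝ) ^ (j + 1)) * r ^ (j + 1)
        ≤ ∑ v, ((r ^ (j + 1)) ^ (j + 2) + (G.degree v : ℝ) ^ (j + 2)) := by
          rw [Finset.sum_mul]
          refine Finset.sum_le_sum fun v _ => ?_
          have := pow_mul_pow_le_add (Nat.cast_nonneg (G.degree v)) (pow_nonneg hr.le (j + 1))
            (j + 1) 1
          rwa [pow_one] at this
      _ ≤ (1 + C₁) * (r ^ (j + 2)) ^ (j + 2) := by
          rw [Finset.sum_add_distrib, ← htot]
          simpa using hds
      _ = _ := by ring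
  refine (Nat.cast_le.2 (copyCount_completeGraph_three_le G)).trans ?_
  rw [Nat.cast_sum]
  simp_rw [Nat.cast_sum]
  refine le_of_mul_le_mul_right ?_ (show (0 : ℝ) < (r ^ j) ^ j by positivity)
  calc (∑ v, ∑ w ∈ G.neighborFinset v, (c v w : ℝ)) * (r ^ j) ^ j
      ≤ ∑ v, ∑ w ∈ G.neighborFinset v, ((r ^ j) ^ (j + 1) + (c v w : ℝ) ^ (j + 1)) := by
        simp_rw [Finset.sum_mul]
        refine Finset.sum_le_sum fun v _ => Finset.sum_le_sum fun w _ => ?_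
        have := pow_mul_pow_le_add (Nat.cast_nonneg (c v w)) (pow_nonneg hr.le j) 1 j
        rwa [pow_one, add_comm 1 j] at this
    _ = (∑ v, (G.degree v : ℝ)) * (r ^ j) ^ (j + 1) +
          ∑ v, ∑ w ∈ G.neighborFinset v, (c v w : ℝ) ^ (j + 1) := by
        simp [Finset.sum_add_distrib, Finset.sum_mul]
    _ ≤ ((1 + C₁) * r ^ (2 * j + 3)) * (r ^ j) ^ (j + 1) +
          C₂ * ((1 + C₁) * r ^ (j ^ 2 + 3 * j + 3)) := by
        gcongr
        exact hcs.trans (by gcongr)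
    _ = (1 + C₁) * (1 + C₂) * r ^ (3 * j + 3) * (r ^ j) ^ j := by ring

theorem generalizedExtremalNumber_le_rpow {s : ℕ} (hs : 2 ≤ s) (t : ℕ) :
    ∃ M : ℝ, ∀ n : ℕ, n ≠ 0 → (generalizedExtremalNumber n
      (SimpleGraph.completeGraph (Fin 3)) (completeBipartiteGraph (Fin s) (Fin t)) : ℝ) ≤
        M * (n : ℝ) ^ (3 - 3 / (s : ℝ)) := by
  classical
  obtain ⟨j, rfl⟩ := Nat.exists_eq_add_of_le' hs
  obtain ⟨M, hM⟩ := copyCount_completeGraph_three_le_of_free j t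
  refine ⟨max M 0, fun n hn => ?_⟩
  have hn0 : (0 : ℝ) < n := by positivity
  set r : ℝ := (n : ℝ) ^ (1 / ((j + 2 : ℕ) : ℝ)) with hr
  have hr0 : 0 < r := by positivity
  have hrn : (n : ℝ) = r ^ (j + 2) := by
    rw [hr, one_div, Real.rpow_inv_natCast_pow hn0.le (by omega)]
  have hexp : r ^ (3 * j + 3) = (n : ℝ) ^ (3 - 3 / ((j + 2 : ℕ) : ℝ)) := by
    rw [hr, ← Real.rpow_natCast, ← Real.rpow_mul hn0.le]
    congr 1
    push_cast
    field_simp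
    ring
  rw [generalizedExtremalNumber, ← hexp]
  obtain h | ⟨G, hG, hGe⟩ := Finset.eq_empty_or_nonempty _ |>.imp_right fun h =>
      Finset.exists_mem_eq_sup
        {G : SimpleGraph (Fin n) | (completeBipartiteGraph (Fin (j + 2)) (Fin t)).Free G} h
        (fun G => G.copyCount (SimpleGraph.completeGraph (Fin 3)))
  · rw [h, Finset.sup_empty]
    simp only [Nat.bot_eq_zero, Nat.cast_zero]
    positivity
  · rw [hGe]
    refine (hM n r hr0 hrn G (Finset.mem_filter.1 hG).2).trans ?_
    gcongr
    exact le_max_left _ _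

/-- For fixed `s ≥ 2` and `t ≥ (s - 1)! + 1`, `ex(n, K_3, K_{s,t}) = Θ(n ^ (3 - 3 / s))`
as `n → ∞`. -/
theorem lemmal91 (s t : ℕ) (hs : 2 ≤ s) (ht : Nat.factorial (s - 1) + 1 ≤ t) :
    Asymptotics.IsTheta Filter.atTop
      (fun n : ℕ => (generalizedExtremalNumber n (SimpleGraph.completeGraph (Fin 3))
        (completeBipartiteGraph (Fin s) (Fin t)) : ℝ))
      (fun n : ℕ => (n : ℝ) ^ (3 - 3 / (s : ℝ))) := by
  obtain ⟨M, hM⟩ := generalizedExtremalNumber_le_rpow hs t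
  obtain ⟨c, hc, hlow⟩ := rpow_le_generalizedExtremalNumber hs ht
  constructor
  · refine Asymptotics.IsBigO.of_bound M ?_
    filter_upwards [Filter.eventually_ne_atTop 0] with n hn
    rw [Real.norm_of_nonneg (Nat.cast_nonneg _), Real.norm_of_nonneg (by positivity)]
    exact hM n hn
  · refine Asymptotics.IsBigO.of_bound c⁻¹ ?_
    filter_upwards [Filter.eventually_ge_atTop ((2 ^ 2) ^ s)] with n hn
    rw [Real.norm_of_nonneg (Nat.cast_nonneg _), Real.norm_of_nonneg (by positivity),
      ← div_eq_inv_mul, le_div_iff₀' hc]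
    exact hlow n hn
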